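/- Let $\mathcal M$ be a Markov decision process with finite state space $S$, finite action space $A$ (all actions available in all states), initial distribution $\mu_0$, transition probabilities $p_a(i,j)$ and payoff distributions with finite means $r_a(i)$. Suppose that $\mathcal M$ is unichain: for each pure policy $\pi:S\to A$ the matrix $(p_{\pi(i)}(i,j))_{i,j\in S}$ is irreducible. Let $V(\pi)=\sum_{i}\mu_\pi(i)\,r_{\pi(i)}(i)$, where $\mu_\pi$ is the invariant distribution of this matrix, let $V^*=\max_\pi V(\pi)$ over all pure policies, and call a pure policy $\pi$ optimal if $V(\pi)=V^*$. Let $\Pi^*$ be a set of optimal pure policies. Let $\sigma$ be any policy that at each visit to each state $i$ randomly chooses an action $a$ such that $a=\pi(i)$ for some $\pi\in\Pi^*$; the probabilities with which these actions are chosen may depend arbitrarily on the time and on all past states, actions and payoffs, and neither these probabilities nor the relative frequencies of the chosen actions need converge. Then $\sigma$ is optimal: if $X_t$, $A_t$, $R_t$ are the state, action and payoff at time $t$ under $\sigma$, then every $R_t$ is integrable and $$\lim_{n\to\infty}\mathbb E\Big[\frac1n\sum_{t=0}^{n-1}R_t\Big]=V^*,$$ and no randomized history-dependent policy has a long-run expected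 average payoff above $V^*$, i.e. for every such policy the upper limit of these expected averages is at most $V^*$. Moreover, almost surely, the average rewards along the trajectory converge to the optimal value: $$\lim_{n\to\infty}\frac1n\sum_{t=0}^{n-1}r_{A_t}(X_t)=\lim_{n\to\infty}\sum_{i\in S}\mu_n(i)\sum_{a\in A}\lambda_i^n(a)\,r_a(i)=V^*,$$ where $\mu_n(i)$ is the relative frequency of visits to $i$ among the first $n$ steps and $\lambda_i^n(a)$ is the relative frequency of the choice of $a$ at these visits. -/

import Mathlib

open MeasureTheory ProbabilityTheory Filter Topology

/-- A Markov decision process with states `S` and actions `A` (every action is available in every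
state): an initial distribution, transition probabilities `p_a(i, j)`, and for each action `a` and
state `i` a payoff distribution on `ℝ` that has a (finite) mean. -/
structure MDP (S A : Type*) where
  /-- the initial distribution -/
  init : PMF S
  /-- `trans a i` is the distribution of the next state when action `a` is chosen in state `i` -/
  trans : A → S → PMF S
  /-- `payoff a i` is the distribution of the random reward for choosing action `a` in state `i` -/
  payoff : A → S → Measure ℝ
  payoff_prob : ∀ a i, IsProbabilityMeasure (payoff a i)
  payoff_integrable : ∀ a i, Integrable (fun x : ℝ => x) (payoff a i)

/-- What happens at one time step: the state, the action chosen in it, the payoff received. -/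
abbrev Stage (S A : Type*) := S × A × ℝ

/-- A general (history-dependent, randomized) policy. At time `n` the action is drawn from a
distribution that may depend on all the states, actions and payoffs at the times `0, …, n - 1`
and on the state at time `n`. -/
structure Policy (S A : Type*) [MeasurableSpace S] [MeasurableSpace A] where
  /-- the distribution of the action at time `n`, given the past and the current state -/
  choose : (n : ℕ) → Kernel ((Fin n → Stage S A) × S) A
  markov : ∀ n, IsMarkovKernel (choose n)

/-- The policy chooses at each visit (that is, at each time and after each past) in each state `i`
randomly an action of the form `π i` with `π ∈ Ps`. Nothing is assumed on how the probabilities of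
these actions vary with the time and with the past. -/
def Policy.Mixes {S A : Type*} [MeasurableSpace S] [MeasurableSpace A] (σ : Policy S A)
    (Ps : Set (S → A)) : Prop :=
  ∀ (n : ℕ) (past : Fin n → Stage S A) (i : S),
    ∀ᵐ a ∂(σ.choose n (past, i)), ∃ π ∈ Ps, a = π i

namespace MDP

section Pure

variable {S A : Type*} (M : MDP S A)

/-- The transition probability `p_a(i, j)`. -/
noncomputable def prob (a : A) (i j : S) : ℝ := (M.trans a i j).toReal

/-- The mean reward `r_a(i)`. -/
noncomputable def meanReward (a : A) (i : S) : ℝ := ∫ x, x ∂(M.payoff a i)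

/-- The transition matrix of the Markov chain induced by the pure policy `π`. -/
noncomputable def matrix (π : S → A) : Matrix S S ℝ := fun i j => M.prob (π i) i j

/-- The process is unichain: every pure policy induces an irreducible Markov chain. -/
def IsUnichain : Prop := ∀ π : S → A, (M.matrix π).IsIrreducible

variable [Fintype S]

/-- `μ` is an invariant distribution of the Markov chain induced by `π`. -/
def IsInvariant (π : S → A) (μ : S → ℝ) : Prop :=
  μ ∈ stdSimplex ℝ S ∧ Matrix.vecMul μ (M.matrix π) = μ

theorem sum_prob (a : A) (i : S) : ∑ j, M.prob a i j = 1 := by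
  have h := (M.trans a i).tsum_coe
  rw [tsum_fintype] at h
  unfold prob
  rw [← ENNReal.toReal_sum (fun j _ => (M.trans a i).apply_ne_top j), h]
  simp

theorem vecMul_mem (π : S → A) {x : S → ℝ} (hx : x ∈ stdSimplex ℝ S) :
    Matrix.vecMul x (M.matrix π) ∈ stdSimplex ℝ S := by
  refine ⟨fun j => Finset.sum_nonneg fun i _ =>
    mul_nonneg (hx.1 i) ENNReal.toReal_nonneg, ?_⟩
  simp only [Matrix.vecMul, dotProduct, matrix]
  rw [Finset.sum_comm]
  simp only [← Finset.mul_sum, sum_prob, mul_one]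
  exact hx.2

/-- Every pure policy has an invariant distribution. -/
theorem exists_isInvariant (π : S → A) : ∃ μ, M.IsInvariant π μ := by
  classical
  obtain ⟨s, -⟩ := M.init.support_nonempty
  let f : (S → ℝ) →ₗ[ℝ] (S → ℝ) := Matrix.vecMulLinear (M.matrix π)
  have hfS : ∀ x ∈ stdSimplex ℝ S, f x ∈ stdSimplex ℝ S := fun x hx => M.vecMul_mem π hx
  let e : ℕ → S → ℝ := fun n => (f ^ n) (Pi.single s 1)
  have he : ∀ n, e n ∈ stdSimplex ℝ S := by
    intro n
    induction n with
    | zero => exact single_mem_stdSimplex ℝ s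
    | succ n ih =>
      have : e (n + 1) = f (e n) := by simp [e, pow_succ']
      rw [this]; exact hfS _ ih
  let x : ℕ → S → ℝ := fun n => ((n : ℝ) + 1)⁻¹ • ∑ k ∈ Finset.range (n + 1), e k
  have hx : ∀ n, x n ∈ stdSimplex ℝ S := by
    intro n
    have hn : (0 : ℝ) < (n : ℝ) + 1 := by positivity
    simp only [x, Finset.smul_sum]
    refine (convex_stdSimplex ℝ S).sum_mem (fun _ _ => by positivity) ?_ (fun k _ => he k)
    simp [hn.ne']
  have hdiff : ∀ n, f (x n) - x n = ((n : ℝ) + 1)⁻¹ • (e (n + 1) - e 0) := by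
    intro n
    have h1 : ∀ k, f (e k) = e (k + 1) := fun k => by simp [e, pow_succ']
    simp only [x, map_smul, map_sum, h1, ← smul_sub, ← Finset.sum_sub_distrib]
    rw [Finset.sum_range_sub]
  obtain ⟨μ, hμ, φ, hφ, hlim⟩ := (isCompact_stdSimplex ℝ S).tendsto_subseq hx
  have hfc : Continuous f := f.continuous_of_finiteDimensional
  have h1 : Tendsto (fun n => f (x (φ n)) - x (φ n)) atTop (𝓝 (f μ - μ)) :=
    ((hfc.tendsto μ).comp hlim).sub hlim
  have h2 : Tendsto (fun n => f (x n) - x n) atTop (𝓝 0) := by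
    simp only [hdiff]
    rw [tendsto_pi_nhds]
    intro j
    have hb : ∀ n, |(e (n + 1) - e 0) j| ≤ 1 := by
      intro n
      have a1 := (he (n + 1)).1 j
      have a2 := (he 0).1 j
      have a3 : e (n + 1) j ≤ 1 := (he (n + 1)).2 ▸
        Finset.single_le_sum (fun i _ => (he (n + 1)).1 i) (Finset.mem_univ j)
      have a4 : e 0 j ≤ 1 := (he 0).2 ▸
        Finset.single_le_sum (fun i _ => (he 0).1 i) (Finset.mem_univ j)
      rw [Pi.sub_apply, abs_le]
      constructor <;> linarith
    refine squeeze_zero_norm (a := fun n : ℕ => 1 / ((n : ℝ) + 1)) (fun n => ?_)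
      tendsto_one_div_add_atTop_nhds_zero_nat
    rw [Pi.smul_apply, smul_eq_mul, norm_mul, Real.norm_eq_abs, Real.norm_eq_abs,
      abs_of_nonneg (by positivity), one_div]
    exact mul_le_of_le_one_right (by positivity) (hb n)
  have h3 : f μ - μ = 0 := tendsto_nhds_unique h1 (h2.comp hφ.tendsto_atTop)
  exact ⟨μ, hμ, sub_eq_zero.1 h3⟩

/-- The invariant distribution of the chain induced by `π` (it is unique if the chain is
irreducible). -/
noncomputable def invariantDist (π : S → A) : S → ℝ := Classical.choose (M.exists_isInvariant π)

/-- The average reward `V(π) = ∑ i, μ(i) r_{π(i)}(i)` of the pure policy `π`. -/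
noncomputable def value (π : S → A) : ℝ := ∑ i, M.invariantDist π i * M.meanReward (π i) i

/-- The pure policy `π` is optimal. -/
def IsOptimal (π : S → A) : Prop := ∀ π' : S → A, M.value π' ≤ M.value π

/-- The optimal average reward: the largest average reward of a pure policy. -/
noncomputable def optimalValue : ℝ := ⨆ π : S → A, M.value π

end Pure

/-- The stages at the times `0, …, n`, as a tuple of length `n + 1`. -/
def toTuple {S A : Type*} (n : ℕ) (h : Finset.Iic n → Stage S A) : Fin (n + 1) → Stage S A :=
  fun k => h ⟨k, Finset.mem_Iic.2 (Nat.lt_succ_iff.1 k.2)⟩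

theorem measurable_toTuple {S A : Type*} [MeasurableSpace S] [MeasurableSpace A] {n : ℕ} :
    Measurable (toTuple (S := S) (A := A) n) :=
  measurable_pi_lambda _ fun _ => measurable_pi_apply _

section Dynamics

variable {S A : Type*} [Fintype S] [Fintype A] [MeasurableSpace S] [MeasurableSpace A]
  [DiscreteMeasurableSpace S] [DiscreteMeasurableSpace A] (M : MDP S A)

/-- The transition probabilities as a Markov kernel from pairs (state, action) to states. -/
noncomputable def transKernel : Kernel (S × A) S where
  toFun x := (M.trans x.2 x.1).toMeasure
  measurable' := Measurable.of_discrete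

instance : IsMarkovKernel M.transKernel := ⟨fun x => by
  change IsProbabilityMeasure (M.trans x.2 x.1).toMeasure; infer_instance⟩

/-- The payoff distributions as a Markov kernel from pairs (state, action) to `ℝ`. -/
noncomputable def payoffKernel : Kernel (S × A) ℝ where
  toFun x := M.payoff x.2 x.1
  measurable' := Measurable.of_discrete

instance : IsMarkovKernel M.payoffKernel := ⟨fun x => M.payoff_prob x.2 x.1⟩

/-- Given the past and the state at time `n`, the joint distribution of the state, the action
(drawn by the policy) and the payoff (drawn from the payoff distribution) at time `n`. -/
noncomputable def stageKernel (σ : Policy S A) (n : ℕ) :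
    Kernel ((Fin n → Stage S A) × S) (Stage S A) :=
  (Kernel.deterministic Prod.snd measurable_snd) ×ₖ
    (σ.choose n ⊗ₖ M.payoffKernel.comap
      (fun y : ((Fin n → Stage S A) × S) × A => (y.1.2, y.2)) (by fun_prop))

instance (σ : Policy S A) (n : ℕ) : IsMarkovKernel (M.stageKernel σ n) := by
  have := σ.markov n
  unfold stageKernel
  infer_instance

/-- The distribution of the stage at time `n + 1`, given the stages at the times `0, …, n`: the
state is drawn according to the transition probabilities, then action and payoff follow. -/
noncomputable def stepKernel (σ : Policy S A) (n : ℕ) :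
    Kernel (Finset.Iic n → Stage S A) (Stage S A) :=
  M.stageKernel σ (n + 1) ∘ₖ
    ((Kernel.deterministic (toTuple n) measurable_toTuple) ×ₖ
      M.transKernel.comap (fun h : Finset.Iic n → Stage S A =>
        ((h ⟨n, Finset.mem_Iic.2 le_rfl⟩).1, (h ⟨n, Finset.mem_Iic.2 le_rfl⟩).2.1)) (by fun_prop))

instance (σ : Policy S A) (n : ℕ) : IsMarkovKernel (M.stepKernel σ n) := by
  unfold stepKernel
  infer_instance

/-- The distribution of the stage at time `0`. -/
noncomputable def startMeasure (σ : Policy S A) : Measure (Stage S A) :=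
  M.stageKernel σ 0 ∘ₘ (M.init.toMeasure.map fun i => (Fin.elim0, i))

instance (σ : Policy S A) : IsProbabilityMeasure (M.startMeasure σ) := by
  have : IsProbabilityMeasure
      (M.init.toMeasure.map fun i => ((Fin.elim0, i) : (Fin 0 → Stage S A) × S)) :=
    Measure.isProbabilityMeasure_map (Measurable.aemeasurable (by fun_prop))
  unfold startMeasure
  infer_instance

/-- The law of the process (states, actions and payoffs at all times) under the policy `σ`, given
by the theorem of Ionescu-Tulcea. -/
noncomputable def law (σ : Policy S A) : Measure (ℕ → Stage S A) :=
  Kernel.trajMeasure (X := fun _ => Stage S A) (M.startMeasure σ) (M.stepKernel σ)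

/-- The expectation of the average `(1 / n) ∑_{t < n} R_t` of the first `n` payoffs. -/
noncomputable def expectedAverage (σ : Policy S A) (n : ℕ) : ℝ :=
  ∫ ω, (∑ t ∈ Finset.range n, (ω t).2.2) / n ∂(M.law σ)

/-- The average of the mean rewards of the first `n` stages of a trajectory `ω`, which is
`∑ i, μ_n(i) ∑ a, λ_i^n(a) r_a(i)` for the relative frequencies `μ_n(i)` of the visits to `i` and
`λ_i^n(a)` of the choice of `a` at these visits. -/
noncomputable def pathAverage (ω : ℕ → Stage S A) (n : ℕ) : ℝ :=
  (∑ t ∈ Finset.range n, M.meanReward (ω t).2.1 (ω t).1) / n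

/-- The policy `σ` attains the average reward `v`: every payoff is integrable, and the expected
average of the first `n` payoffs tends to `v`. -/
def HasAverageReward (σ : Policy S A) (v : ℝ) : Prop :=
  (∀ t : ℕ, Integrable (fun ω : ℕ → Stage S A => (ω t).2.2) (M.law σ)) ∧
    Tendsto (M.expectedAverage σ) atTop (𝓝 v)

/-- The general policy `σ` is optimal: its average reward exists and is the largest average
reward of a pure policy, and no general policy does better in the long run. -/
def IsOptimalPolicy (σ : Policy S A) : Prop :=
  M.HasAverageReward σ M.optimalValue ∧
    ∀ σ' : Policy S A, ∀ ε > 0, ∀ᶠ n in atTop, M.expectedAverage σ' n < M.optimalValue + ε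

end Dynamics

end MDP

/-!
Solve the Poisson equation of an optimal pure policy: its value `g` and a bias `h` make the
advantage `r_a(i) + ∑ j, p_a(i, j) h(j) - g - h(i)` vanish for the actions of that policy. Switching
the policy to an action `a` in a single state `i` changes the value by a positive multiple of the
advantage of `a` in `i`, so no advantage is positive. The advantages of the actions of any other
optimal policy average to `0` over its invariant distribution, so they vanish as well.

Along a trajectory the mean reward `r_{A_t}(X_t)` is `g` plus the advantage, plus the martingale
difference `h(X_{t+1}) - 𝔼[h(X_{t+1}) | X_t, A_t]`, plus the telescoping term `h(X_t) - h(X_{t+1})`.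
After averaging, the telescoping term tends to `0`, and so does the martingale term: in expectation
because it has mean zero, almost surely by a strong law for bounded orthogonal variables. The
average advantage is never positive, and it is zero for a policy that mixes optimal pure policies.
-/

section IrreducibleStochastic

variable {n R : Type*}

theorem mem_of_isIrreducible_of_closed [Ring R] [LinearOrder R] {P : Matrix n n R}
    (hP : P.IsIrreducible) {T : Set n} (hT : ∀ i ∈ T, ∀ j, 0 < P i j → j ∈ T) {i : n}
    (hi : i ∈ T) (j : n) : j ∈ T := by
  let : Quiver n := P.toQuiver
  obtain ⟨p, -⟩ := hP.connected i j
  induction p with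
  | nil => exact hi
  | cons _ e ih => exact hT _ ih _ e.down

variable [Field R] [LinearOrder R] [IsStrictOrderedRing R] [Fintype n] {P : Matrix n n R}
  {μ h : n → R}

theorem pos_of_isIrreducible_of_vecMul_eq (hP : P.IsIrreducible) (hμ : μ ∈ stdSimplex R n)
    (hμP : Matrix.vecMul μ P = μ) (i : n) : 0 < μ i := by
  obtain ⟨k, -, hk⟩ : ∃ k ∈ Finset.univ, 0 < μ k :=
    Finset.exists_lt_of_sum_lt (by simp [hμ.2])
  refine mem_of_isIrreducible_of_closed hP (T := {i | 0 < μ i}) (fun i hi j hij => ?_) hk i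
  rw [Set.mem_ofPred_eq, ← congrFun hμP j]
  exact Finset.sum_pos' (fun l _ => mul_nonneg (hμ.1 l) (hP.nonneg l j))
    ⟨i, Finset.mem_univ i, mul_pos hi hij⟩

theorem eq_of_isIrreducible_of_harmonic (hP : P.IsIrreducible) (hP1 : Matrix.mulVec P 1 = 1)
    (hh : Matrix.mulVec P h = h) (i j : n) : h i = h j := by
  have : Nonempty n := ⟨i⟩
  obtain ⟨m, hm⟩ := Finite.exists_max h
  suffices h_max : ∀ k, h k = h m by rw [h_max i, h_max j]
  refine mem_of_isIrreducible_of_closed hP (T := {k | h k = h m}) (fun k hk l hkl => ?_) rfl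
  have h_gap : ∀ j, 0 ≤ (h m • 1 - h) j := fun j => by simpa using hm j
  have h_sum : Matrix.mulVec P (h m • 1 - h) k = 0 := by
    rw [Matrix.mulVec_sub, Matrix.mulVec_smul, hP1, hh]
    simpa [sub_eq_zero, eq_comm] using hk
  have h_term := (Finset.sum_eq_zero_iff_of_nonneg fun j _ =>
    mul_nonneg (hP.nonneg k j) (h_gap j)).1 h_sum l (Finset.mem_univ l)
  simpa [sub_eq_zero, eq_comm] using (mul_eq_zero.1 h_term).resolve_left hkl.ne'

/- `h ↦ h - P h + (μ · h) 1` is injective, hence onto: pairing it with `μ` leaves only `μ · h`, so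
an element of its kernel is harmonic with `μ`-mean zero. -/
theorem exists_poisson_of_isIrreducible (hP : P.IsIrreducible) (hP1 : Matrix.mulVec P 1 = 1)
    (hμ : μ ∈ stdSimplex R n) (hμP : Matrix.vecMul μ P = μ) (f : n → R) :
    ∃ h : n → R, f + Matrix.mulVec P h = (μ ⬝ᵥ f) • 1 + h := by
  let L : (n → R) →ₗ[R] (n → R) :=
    LinearMap.id - P.mulVecLin + (dotProductBilin R R μ).smulRight 1
  have hL : ∀ h, L h = h - Matrix.mulVec P h + (μ ⬝ᵥ h) • 1 := fun _ => rfl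
  have hμ1 : μ ⬝ᵥ 1 = 1 := by rw [dotProduct_one, hμ.2]
  have hμL : ∀ h, μ ⬝ᵥ L h = μ ⬝ᵥ h := fun h => by
    rw [hL, dotProduct_add, dotProduct_sub, Matrix.dotProduct_mulVec, hμP, dotProduct_smul, hμ1]
    simp
  have hL_inj : Function.Injective L := by
    refine (injective_iff_map_eq_zero L).2 fun h hh => ?_
    have h_mean : μ ⬝ᵥ h = 0 := by rw [← hμL, hh, dotProduct_zero]
    have h_harmonic : Matrix.mulVec P h = h := by
      rw [hL, h_mean, zero_smul, add_zero, sub_eq_zero] at hh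
      exact hh.symm
    ext i
    have h_const : h = h i • 1 := funext fun j => by
      simpa using eq_of_isIrreducible_of_harmonic hP hP1 h_harmonic j i
    rw [h_const, dotProduct_smul, hμ1] at h_mean
    simpa using h_mean
  obtain ⟨h, hh⟩ := LinearMap.injective_iff_surjective.1 hL_inj f
  refine ⟨h, ?_⟩
  have h_mean : μ ⬝ᵥ h = μ ⬝ᵥ f := by rw [← hμL, hh]
  rw [← h_mean, ← hh, hL]
  abel

end IrreducibleStochastic

section StrongLaw

theorem tendsto_div_of_monotone_of_tendsto_sq {u : ℕ → ℝ} {l : ℝ} (hu : Monotone u)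
    (hlim : Tendsto (fun k : ℕ => u (k ^ 2) / (k : ℝ) ^ 2) atTop (𝓝 l)) :
    Tendsto (fun n : ℕ => u n / n) atTop (𝓝 l) := by
  refine tendsto_div_of_monotone_of_exists_subseq_tendsto_div u l hu fun a ha =>
    ⟨fun k => k ^ 2, ?_, tendsto_pow_atTop two_ne_zero, by simpa only [Nat.cast_pow] using hlim⟩
  have h_ratio : Tendsto (fun k : ℕ => (1 + 1 / (k : ℝ)) ^ 2) atTop (𝓝 1) := by
    simpa using (tendsto_one_div_atTop_nhds_zero_nat (𝕜 := ℝ)).const_add 1 |>.pow 2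
  filter_upwards [h_ratio.eventually_le_const ha, eventually_gt_atTop 0] with k hk hk_pos
  have : (0 : ℝ) < k := by exact_mod_cast hk_pos
  calc (((k + 1) ^ 2 : ℕ) : ℝ) = (1 + 1 / (k : ℝ)) ^ 2 * (k : ℝ) ^ 2 := by
        push_cast; field_simp
    _ ≤ a * ((k ^ 2 : ℕ) : ℝ) := by push_cast; gcongr

theorem tendsto_sum_div_of_tendsto_sq {d : ℕ → ℝ} {C l : ℝ} (hd : ∀ t, -C ≤ d t)
    (hlim : Tendsto (fun k : ℕ => (∑ t ∈ Finset.range (k ^ 2), d t) / (k : ℝ) ^ 2) atTop (𝓝 l)) :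
    Tendsto (fun n : ℕ => (∑ t ∈ Finset.range n, d t) / n) atTop (𝓝 l) := by
  let u : ℕ → ℝ := fun n => ∑ t ∈ Finset.range n, (d t + C)
  have hu : Monotone u := fun m n hmn => Finset.sum_le_sum_of_subset_of_nonneg
    (Finset.range_mono hmn) fun t _ _ => by linarith [hd t]
  have hu_div : ∀ n : ℕ, n ≠ 0 → u n / n = (∑ t ∈ Finset.range n, d t) / n + C := fun n hn => by
    simp only [u, Finset.sum_add_distrib, Finset.sum_const, Finset.card_range, nsmul_eq_mul]
    field_simp
  have hu_sq : Tendsto (fun k : ℕ => u (k ^ 2) / (k : ℝ) ^ 2) atTop (𝓝 (l + C)) := by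
    refine (hlim.add_const C).congr' ?_
    filter_upwards [eventually_ne_atTop 0] with k hk
    simpa only [Nat.cast_pow] using (hu_div (k ^ 2) (pow_ne_zero 2 hk)).symm
  have hu_lim := (tendsto_div_of_monotone_of_tendsto_sq hu hu_sq).sub_const C
  rw [add_sub_cancel_right] at hu_lim
  refine hu_lim.congr' ?_
  filter_upwards [eventually_ne_atTop 0] with n hn
  rw [hu_div n hn, add_sub_cancel_right]

theorem tendsto_sub_div_of_abs_le {u : ℕ → ℝ} {K : ℝ} (hu : ∀ n, |u n| ≤ K) :
    Tendsto (fun n : ℕ => (u 0 - u n) / n) atTop (𝓝 0) := by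
  refine squeeze_zero_norm (fun n => ?_) (tendsto_const_div_atTop_nhds_zero_nat (2 * K))
  rw [norm_div, Real.norm_natCast]
  gcongr
  exact (norm_sub_le_of_le (hu 0) (hu n)).trans_eq (two_mul K).symm

variable {Ω : Type*} {mΩ : MeasurableSpace Ω} {μ : Measure Ω}

theorem ae_tendsto_zero_of_summable_integral_norm {E : Type*} [NormedAddCommGroup E]
    {f : ℕ → Ω → E} (hf : ∀ k, Integrable (f k) μ) (hsum : Summable fun k => ∫ ω, ‖f k ω‖ ∂μ) :
    ∀ᵐ ω ∂μ, Tendsto (fun k => f k ω) atTop (𝓝 0) := by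
  have h_tsum : ∑' k, eLpNorm (f k) 1 μ ≠ ⊤ := by
    simp_rw [eLpNorm_one_eq_lintegral_enorm, ← ofReal_integral_norm_eq_lintegral_enorm (hf _)]
    exact hsum.tsum_ofReal_ne_top
  filter_upwards [summable_norm_of_tsum_eLpNorm_ne_top le_rfl
    (fun k => (hf k).aestronglyMeasurable) h_tsum] with ω hω
  exact tendsto_zero_iff_norm_tendsto_zero.2 hω.tendsto_atTop_zero

theorem integral_sq_sum_of_orthogonal {ι : Type*} {D : ι → Ω → ℝ} (hD : ∀ i, MemLp (D i) 2 μ)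
    (horth : Pairwise fun i j => ∫ ω, D i ω * D j ω ∂μ = 0) (s : Finset ι) :
    ∫ ω, (∑ i ∈ s, D i ω) ^ 2 ∂μ = ∑ i ∈ s, ∫ ω, D i ω ^ 2 ∂μ := by
  have h_mul : ∀ i j, Integrable (fun ω => D i ω * D j ω) μ := fun i j =>
    (hD i).integrable_mul (hD j)
  simp_rw [sq, Finset.sum_mul_sum]
  rw [integral_finsetSum _ fun i _ => integrable_finsetSum _ fun j _ => h_mul i j]
  refine Finset.sum_congr rfl fun i hi => ?_
  rw [integral_finsetSum _ fun j _ => h_mul i j]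
  exact Finset.sum_eq_single_of_mem i hi fun j _ hji => horth hji.symm

/- The averages along the squares have summable second moments `O(1 / k ^ 2)`; the lower bound `-C`
makes the sums of `D t + C` monotone, which controls the averages between consecutive squares. -/
theorem ae_tendsto_sum_div_of_orthogonal {D : ℕ → Ω → ℝ} {C K : ℝ} (hD : ∀ t, MemLp (D t) 2 μ)
    (hC : ∀ t, ∀ᵐ ω ∂μ, -C ≤ D t ω) (hK : ∀ t, ∫ ω, D t ω ^ 2 ∂μ ≤ K)
    (horth : Pairwise fun s t => ∫ ω, D s ω * D t ω ∂μ = 0) :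
    ∀ᵐ ω ∂μ, Tendsto (fun n : ℕ => (∑ t ∈ Finset.range n, D t ω) / n) atTop (𝓝 0) := by
  let Z : ℕ → Ω → ℝ := fun k ω => ((∑ t ∈ Finset.range (k ^ 2), D t ω) / (k : ℝ) ^ 2) ^ 2
  have hZ : ∀ k, Integrable (Z k) μ := fun k => by
    simp only [Z, div_pow]
    exact (memLp_finsetSum _ fun t _ => hD t).integrable_sq.div_const _
  have hZ_le : ∀ k, ∫ ω, ‖Z k ω‖ ∂μ ≤ K * (1 / (k : ℝ) ^ 2) := fun k => by
    have h_sum : ∑ t ∈ Finset.range (k ^ 2), ∫ ω, D t ω ^ 2 ∂μ ≤ ((k ^ 2 : ℕ) : ℝ) * K :=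
      (Finset.sum_le_card_nsmul _ _ K fun t _ => hK t).trans_eq (by simp)
    simp only [Z, Real.norm_of_nonneg (sq_nonneg _)]
    simp only [div_pow, integral_div, integral_sq_sum_of_orthogonal hD horth]
    rcases eq_or_ne k 0 with rfl | hk
    · simp
    · rw [div_le_iff₀ (by positivity)]
      exact h_sum.trans_eq (by push_cast; field_simp)
  have hZ_sum : Summable fun k => ∫ ω, ‖Z k ω‖ ∂μ :=
    Summable.of_nonneg_of_le (fun k => integral_nonneg fun _ => norm_nonneg _) hZ_le
      ((Real.summable_one_div_nat_pow.2 one_lt_two).mul_left K)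
  filter_upwards [ae_tendsto_zero_of_summable_integral_norm hZ hZ_sum, ae_all_iff.2 hC]
    with ω hω hCω
  refine tendsto_sum_div_of_tendsto_sq hCω ?_
  simpa [Z, Real.sqrt_sq_eq_abs, tendsto_zero_iff_abs_tendsto_zero, Function.comp_def]
    using hω.sqrt

end StrongLaw

section TrajMeasure

variable {X : ℕ → Type*} [∀ n, MeasurableSpace (X n)] {μ₀ : Measure (X 0)}
  {κ : (n : ℕ) → Kernel ((i : Finset.Iic n) → X i) (X (n + 1))} [∀ n, IsMarkovKernel (κ n)]

theorem map_eval_zero_trajMeasure : (Kernel.trajMeasure μ₀ κ).map (fun ω => ω 0) = μ₀ := by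
  have h_eval : (fun ω : (n : ℕ) → X n => ω 0) =
      (fun x : (i : Finset.Iic 0) → X i => x ⟨0, Finset.mem_Iic.2 le_rfl⟩) ∘
        Preorder.frestrictLe 0 := rfl
  rw [h_eval, ← Measure.map_map (by fun_prop) (by fun_prop), Kernel.trajMeasure,
    Measure.map_comp _ _ (by fun_prop), Kernel.traj_map_frestrictLe, Kernel.partialTraj_self,
    Measure.id_comp]
  exact (Measure.map_map (measurable_pi_apply _) (MeasurableEquiv.measurable _)).trans
    Measure.map_id

variable [IsProbabilityMeasure μ₀]

theorem map_eval_succ_trajMeasure (n : ℕ) :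
    (Kernel.trajMeasure μ₀ κ).map (fun ω => ω (n + 1)) =
      κ n ∘ₘ (Kernel.trajMeasure μ₀ κ).map (Preorder.frestrictLe n) := by
  rw [← Measure.snd_compProd, Kernel.map_frestrictLe_trajMeasure_compProd_eq_map_trajMeasure,
    Measure.snd, Measure.map_map measurable_snd (by fun_prop)]
  rfl

theorem integral_trajMeasure_succ {E : Type*} [NormedAddCommGroup E] [NormedSpace ℝ E] {n : ℕ}
    {f : ((i : Finset.Iic n) → X i) × X (n + 1) → E} (hf : StronglyMeasurable f)
    (hf_int : Integrable (fun ω => f (Preorder.frestrictLe n ω, ω (n + 1)))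
      (Kernel.trajMeasure μ₀ κ)) :
    ∫ ω, f (Preorder.frestrictLe n ω, ω (n + 1)) ∂(Kernel.trajMeasure μ₀ κ) =
      ∫ ω, ∫ y, f (Preorder.frestrictLe n ω, y) ∂(κ n (Preorder.frestrictLe n ω))
        ∂(Kernel.trajMeasure μ₀ κ) := by
  have h_meas : Measurable fun ω : (n : ℕ) → X n => (Preorder.frestrictLe n ω, ω (n + 1)) := by
    fun_prop
  have h_law := Kernel.map_frestrictLe_trajMeasure_compProd_eq_map_trajMeasure (μ₀ := μ₀) (κ := κ)
    (a := n)
  have h_int := (integrable_map_measure hf.aestronglyMeasurable h_meas.aemeasurable).2 hf_int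
  rw [← h_law] at h_int
  calc ∫ ω, f (Preorder.frestrictLe n ω, ω (n + 1)) ∂(Kernel.trajMeasure μ₀ κ)
    _ = ∫ z, f z ∂((Kernel.trajMeasure μ₀ κ).map (Preorder.frestrictLe n) ⊗ₘ κ n) := by
      rw [h_law, integral_map h_meas.aemeasurable hf.aestronglyMeasurable]
    _ = ∫ x, ∫ y, f (x, y) ∂(κ n x) ∂((Kernel.trajMeasure μ₀ κ).map (Preorder.frestrictLe n)) :=
      Measure.integral_compProd h_int
    _ = _ := integral_map (by fun_prop) hf.integral_kernel_prod_right'.aestronglyMeasurable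

end TrajMeasure

theorem integrable_comp_of_finite {Ω α E : Type*} [MeasurableSpace Ω] [Finite α]
    [MeasurableSpace α] [DiscreteMeasurableSpace α] [NormedAddCommGroup E] {μ : Measure Ω}
    [IsFiniteMeasure μ] {X : Ω → α} (hX : Measurable X) (f : α → E) :
    Integrable (fun ω => f (X ω)) μ :=
  Integrable.comp_measurable (f := X) (g := f) Integrable.of_finite hX

namespace MDP

section OptimalityEquation

variable {S A : Type*} [Fintype S] {M : MDP S A} {π : S → A}

theorem matrix_mulVec_one (M : MDP S A) (π : S → A) : Matrix.mulVec (M.matrix π) 1 = 1 := by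
  ext i
  simpa [Matrix.mulVec, dotProduct, matrix] using M.sum_prob (π i) i

theorem isInvariant_invariantDist (M : MDP S A) (π : S → A) :
    M.IsInvariant π (M.invariantDist π) :=
  Classical.choose_spec (M.exists_isInvariant π)

theorem invariantDist_pos (hπ : (M.matrix π).IsIrreducible) (i : S) : 0 < M.invariantDist π i :=
  have ⟨h_mem, h_eq⟩ := M.isInvariant_invariantDist π
  pos_of_isIrreducible_of_vecMul_eq hπ h_mem h_eq i

/-- The advantage `r_a(i) + ∑ j, p_a(i, j) h(j) - g - h(i)` of the action `a` in the state `i`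
relative to the gain `g` and the bias `h`: the residual of the average-reward optimality
equation. -/
noncomputable def advantage (M : MDP S A) (g : ℝ) (h : S → ℝ) (a : A) (i : S) : ℝ :=
  M.meanReward a i + ∑ j, M.prob a i j * h j - g - h i

theorem sum_invariantDist_mul_advantage (M : MDP S A) (π : S → A) (g : ℝ) (h : S → ℝ) :
    ∑ i, M.invariantDist π i * M.advantage g h (π i) i = M.value π - g := by
  obtain ⟨⟨-, h_sum⟩, h_eq⟩ := M.isInvariant_invariantDist π
  have h_stationary : ∑ i, M.invariantDist π i * ∑ j, M.prob (π i) i j * h j =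
      ∑ i, M.invariantDist π i * h i :=
    (Matrix.dotProduct_mulVec (M.invariantDist π) (M.matrix π) h).trans (by rw [h_eq]; rfl)
  simp only [advantage, mul_sub, mul_add, Finset.sum_sub_distrib, Finset.sum_add_distrib,
    h_stationary, ← Finset.sum_mul, h_sum, value]
  ring

theorem exists_advantage_value_eq_zero (hπ : (M.matrix π).IsIrreducible) :
    ∃ h : S → ℝ, ∀ i, M.advantage (M.value π) h (π i) i = 0 := by
  obtain ⟨h_mem, h_eq⟩ := M.isInvariant_invariantDist π
  obtain ⟨h, hh⟩ := exists_poisson_of_isIrreducible hπ (M.matrix_mulVec_one π) h_mem h_eq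
    fun i => M.meanReward (π i) i
  refine ⟨h, fun i => ?_⟩
  have h_poisson : M.meanReward (π i) i + ∑ j, M.prob (π i) i j * h j = M.value π * 1 + h i :=
    congrFun hh i
  rw [advantage, h_poisson]
  ring

theorem IsOptimal.value_eq (hπ : M.IsOptimal π) : M.value π = M.optimalValue :=
  (IsGreatest.csSup_eq ⟨Set.mem_range_self π, Set.forall_mem_range.2 hπ⟩).symm

theorem IsOptimal.advantage_nonpos (hM : M.IsUnichain) (hπ : M.IsOptimal π) {g : ℝ} {h : S → ℝ}
    (hh : ∀ i, M.advantage g h (π i) i = 0) (a : A) (i : S) : M.advantage g h a i ≤ 0 := by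
  classical
  have h_gain : M.value π = g := by
    simpa [hh, eq_comm, sub_eq_zero] using M.sum_invariantDist_mul_advantage π g h
  -- Switching `π` to `a` at `i` alone changes the value by `μ(i)` times the advantage.
  let π' := Function.update π i a
  have h_diff : M.invariantDist π' i * M.advantage g h a i = M.value π' - g := by
    rw [← sum_invariantDist_mul_advantage M π' g h, Finset.sum_eq_single i]
    · simp [π']
    · intro j _ hj
      simp [π', hj, hh]
    · simp
  have h_le : M.invariantDist π' i * M.advantage g h a i ≤ 0 := by
    rw [h_diff, ← h_gain]
    exact sub_nonpos.2 (hπ π')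
  exact nonpos_of_mul_nonpos_right h_le (invariantDist_pos (hM π') i)

theorem IsOptimal.advantage_eq_zero (hM : M.IsUnichain) (hπ : M.IsOptimal π) {h : S → ℝ}
    (hh : ∀ a i, M.advantage M.optimalValue h a i ≤ 0) (i : S) :
    M.advantage M.optimalValue h (π i) i = 0 := by
  have h_pos := invariantDist_pos (hM π)
  have h_sum : ∑ i, M.invariantDist π i * M.advantage M.optimalValue h (π i) i = 0 := by
    rw [sum_invariantDist_mul_advantage, hπ.value_eq, sub_self]
  have h_term := (Finset.sum_eq_zero_iff_of_nonpos fun j _ =>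
    mul_nonpos_of_nonneg_of_nonpos (h_pos j).le (hh (π j) j)).1 h_sum i (Finset.mem_univ i)
  exact (mul_eq_zero.1 h_term).resolve_left (h_pos i).ne'

theorem exists_optimality_equation [Finite A] [Nonempty A] (hM : M.IsUnichain) :
    ∃ h : S → ℝ, (∀ a i, M.advantage M.optimalValue h a i ≤ 0) ∧
      ∀ π, M.IsOptimal π → ∀ i, M.advantage M.optimalValue h (π i) i = 0 := by
  obtain ⟨π, hπ : M.IsOptimal π⟩ := Finite.exists_max M.value
  obtain ⟨h, hh⟩ := exists_advantage_value_eq_zero (hM π)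
  have h_nonpos := hπ.advantage_nonpos hM (hπ.value_eq ▸ hh)
  exact ⟨h, h_nonpos, fun π' hπ' => hπ'.advantage_eq_zero hM h_nonpos⟩

end OptimalityEquation

section Law

variable {S A : Type*} [Fintype S] [Fintype A] [MeasurableSpace S] [MeasurableSpace A]
  [DiscreteMeasurableSpace S] [DiscreteMeasurableSpace A] (M : MDP S A) (σ : Policy S A) (n : ℕ)

instance : IsProbabilityMeasure (M.law σ) := by
  unfold law
  infer_instance

theorem map_prodAssoc_symm_stageKernel :
    (M.stageKernel σ n).map MeasurableEquiv.prodAssoc.symm =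
      (Kernel.id ×ₖ M.payoffKernel) ∘ₖ
        (Kernel.deterministic Prod.snd measurable_snd ×ₖ σ.choose n) := by
  have := σ.markov n
  refine Kernel.ext_fun fun x f hf => ?_
  rw [Kernel.lintegral_map _ (by fun_prop) _ hf, stageKernel,
    Kernel.lintegral_deterministic_prod _ _ _ (by fun_prop),
    Kernel.lintegral_compProd _ _ _ (by fun_prop), Kernel.lintegral_comp _ _ _ hf,
    Kernel.lintegral_deterministic_prod _ _ _ (by fun_prop)]
  simp only [Kernel.lintegral_id_prod hf]
  rfl

theorem exists_map_eval_law :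
    ∃ ν : Measure ((Fin n → Stage S A) × S), IsProbabilityMeasure ν ∧
      (M.law σ).map (fun ω => ω n) = M.stageKernel σ n ∘ₘ ν := by
  cases n with
  | zero => exact ⟨_, Measure.isProbabilityMeasure_map (by fun_prop), map_eval_zero_trajMeasure⟩
  | succ n =>
    have : IsProbabilityMeasure
        ((M.law σ).map (Preorder.frestrictLe (π := fun _ => Stage S A) n)) :=
      Measure.isProbabilityMeasure_map (by fun_prop)
    have h_law : (M.law σ).map (fun ω => ω (n + 1)) =
        M.stepKernel σ n ∘ₘ (M.law σ).map (Preorder.frestrictLe n) := map_eval_succ_trajMeasure n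
    rw [h_law, stepKernel, ← Measure.comp_assoc]
    exact ⟨_, inferInstance, rfl⟩

theorem exists_map_stage_law :
    ∃ ν : Measure ((Fin n → Stage S A) × S), IsProbabilityMeasure ν ∧
      (M.law σ).map (fun ω => (((ω n).1, (ω n).2.1), (ω n).2.2)) =
        ((Kernel.deterministic Prod.snd measurable_snd ×ₖ σ.choose n) ∘ₘ ν) ⊗ₘ
          M.payoffKernel := by
  have := σ.markov n
  obtain ⟨ν, hν, h⟩ := M.exists_map_eval_law σ n
  refine ⟨ν, hν, ?_⟩
  rw [Measure.compProd_eq_comp_prod, Measure.comp_assoc, ← map_prodAssoc_symm_stageKernel,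
    ← Measure.map_comp _ _ (by fun_prop), ← h, Measure.map_map (by fun_prop) (by fun_prop)]
  rfl

theorem exists_map_stateAction_law :
    ∃ ν : Measure ((Fin n → Stage S A) × S),
      (M.law σ).map (fun ω => ((ω n).1, (ω n).2.1)) =
        (Kernel.deterministic Prod.snd measurable_snd ×ₖ σ.choose n) ∘ₘ ν := by
  have := σ.markov n
  obtain ⟨ν, _, h⟩ := M.exists_map_stage_law σ n
  exact ⟨ν, by rw [← Measure.fst_map_prodMk (X := fun ω : ℕ → Stage S A => ((ω n).1, (ω n).2.1))
    (Y := fun ω => (ω n).2.2) (by fun_prop), h, Measure.fst_compProd]⟩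

theorem map_stage_law :
    (M.law σ).map (fun ω => (((ω n).1, (ω n).2.1), (ω n).2.2)) =
      (M.law σ).map (fun ω => ((ω n).1, (ω n).2.1)) ⊗ₘ M.payoffKernel := by
  have := σ.markov n
  obtain ⟨ν, _, h⟩ := M.exists_map_stage_law σ n
  rw [← Measure.fst_map_prodMk (X := fun ω : ℕ → Stage S A => ((ω n).1, (ω n).2.1))
    (Y := fun ω => (ω n).2.2) (by fun_prop), h, Measure.fst_compProd]

variable {σ} in
theorem ae_exists_eq_of_mixes {Ps : Set (S → A)} (hσ : σ.Mixes Ps) :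
    ∀ᵐ ω ∂(M.law σ), ∃ π ∈ Ps, (ω n).2.1 = π (ω n).1 := by
  have := σ.markov n
  obtain ⟨ν, h⟩ := M.exists_map_stateAction_law σ n
  have hs : MeasurableSet {p : S × A | ∃ π ∈ Ps, p.2 = π p.1} := MeasurableSet.of_discrete
  refine (ae_map_iff (f := fun ω : ℕ → Stage S A => ((ω n).1, (ω n).2.1)) (by fun_prop) hs).1 ?_
  rw [h, Measure.ae_comp_iff hs]
  refine Eventually.of_forall fun x => ?_
  rw [Kernel.prod_apply, Kernel.deterministic_apply, Measure.dirac_prod,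
    ae_map_iff (by fun_prop) hs]
  exact hσ n x.1 x.2

theorem integrable_snd_compProd_payoffKernel (ρ : Measure (S × A)) [IsFiniteMeasure ρ] :
    Integrable Prod.snd (ρ ⊗ₘ M.payoffKernel) :=
  (Measure.integrable_compProd_iff measurable_snd.aestronglyMeasurable).2
    ⟨Eventually.of_forall fun x => M.payoff_integrable x.2 x.1, Integrable.of_finite⟩

theorem integrable_payoff_law : Integrable (fun ω => (ω n).2.2) (M.law σ) := by
  have h_int := M.integrable_snd_compProd_payoffKernel
    ((M.law σ).map fun ω => ((ω n).1, (ω n).2.1))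
  rw [← map_stage_law] at h_int
  exact h_int.comp_measurable (by fun_prop)

theorem integral_payoff_law :
    ∫ ω, (ω n).2.2 ∂(M.law σ) = ∫ ω, M.meanReward (ω n).2.1 (ω n).1 ∂(M.law σ) :=
  calc ∫ ω, (ω n).2.2 ∂(M.law σ)
    _ = ∫ z, z.2 ∂((M.law σ).map fun ω => (((ω n).1, (ω n).2.1), (ω n).2.2)) :=
      (integral_map (μ := M.law σ) (φ := fun ω => (((ω n).1, (ω n).2.1), (ω n).2.2))
        (by fun_prop) measurable_snd.aestronglyMeasurable).symm
    _ = ∫ p, M.meanReward p.2 p.1 ∂((M.law σ).map fun ω => ((ω n).1, (ω n).2.1)) := by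
      rw [map_stage_law, Measure.integral_compProd (M.integrable_snd_compProd_payoffKernel _)]
      rfl
    _ = _ := integral_map (by fun_prop) Measurable.of_discrete.aestronglyMeasurable

end Law

section TransError

variable {S A : Type*} [Fintype S] (M : MDP S A) (h : S → ℝ)

/-- The deviation of `h` at the state of the stage `y` from its conditional expectation given the
preceding stage `x`. Along a trajectory these are martingale differences. -/
noncomputable def transError (x y : Stage S A) : ℝ := h y.1 - ∑ j, M.prob x.2.1 x.1 j * h j

theorem abs_transError_le (x y : Stage S A) : |M.transError h x y| ≤ 2 * ‖h‖ := by
  have h_mean : ∑ j, M.prob x.2.1 x.1 j • h j ∈ Metric.closedBall (0 : ℝ) ‖h‖ :=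
    (convex_closedBall _ _).sum_mem (fun _ _ => ENNReal.toReal_nonneg) (M.sum_prob _ _)
      fun j _ => mem_closedBall_zero_iff.2 (norm_le_pi_norm h j)
  exact (norm_sub_le_of_le (norm_le_pi_norm h y.1) (mem_closedBall_zero_iff.1 h_mean)).trans_eq
    (two_mul _).symm

variable [MeasurableSpace S] [MeasurableSpace A]
  [DiscreteMeasurableSpace S] [DiscreteMeasurableSpace A]

@[fun_prop]
theorem measurable_transError [Finite A] {Ω : Type*} {mΩ : MeasurableSpace Ω} {X Y : Ω → Stage S A}
    (hX : Measurable X) (hY : Measurable Y) :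
    Measurable fun ω => M.transError h (X ω) (Y ω) :=
  (Measurable.of_discrete
    (f := fun p : (S × A) × S => h p.2 - ∑ j, M.prob p.1.2 p.1.1 j * h j)).comp
    (f := fun ω => (((X ω).1, (X ω).2.1), (Y ω).1)) (by fun_prop)

variable [Fintype A] (σ : Policy S A)

theorem fst_stepKernel (n : ℕ) :
    (M.stepKernel σ n).fst = M.transKernel.comap (fun x : Finset.Iic n → Stage S A =>
      ((x ⟨n, Finset.mem_Iic.2 le_rfl⟩).1, (x ⟨n, Finset.mem_Iic.2 le_rfl⟩).2.1))
      (by fun_prop) := by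
  have := σ.markov (n + 1)
  have h_stage : (M.stageKernel σ (n + 1)).fst = Kernel.deterministic Prod.snd measurable_snd := by
    rw [stageKernel, Kernel.fst_prod]
  rw [stepKernel, Kernel.fst_comp, h_stage, Kernel.deterministic_comp_eq_map, ← Kernel.snd_eq,
    Kernel.snd_prod]

theorem integral_transError_stepKernel (n : ℕ) (x : Finset.Iic n → Stage S A) :
    ∫ y, M.transError h (x ⟨n, Finset.mem_Iic.2 le_rfl⟩) y ∂(M.stepKernel σ n x) = 0 := by
  set z := x ⟨n, Finset.mem_Iic.2 le_rfl⟩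
  have h_mean : ∫ y, h y.1 ∂(M.stepKernel σ n x) = ∑ j, M.prob z.2.1 z.1 j * h j :=
    calc ∫ y, h y.1 ∂(M.stepKernel σ n x)
      _ = ∫ j, h j ∂((M.stepKernel σ n).fst x) := by
        rw [Kernel.fst_apply,
          integral_map (by fun_prop) Measurable.of_discrete.aestronglyMeasurable]
      _ = ∫ j, h j ∂(M.trans z.2.1 z.1).toMeasure := by rw [fst_stepKernel]; rfl
      _ = ∑ j, M.prob z.2.1 z.1 j * h j := PMF.integral_eq_sum _ _
  simp only [transError]
  rw [integral_sub (integrable_comp_of_finite measurable_fst h) (integrable_const _), h_mean]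
  simp

theorem integral_mul_transError_law {n : ℕ} {g : (Finset.Iic n → Stage S A) → ℝ}
    (hg : Measurable g) {C : ℝ} (hC : ∀ x, |g x| ≤ C) :
    ∫ ω, g (Preorder.frestrictLe n ω) * M.transError h (ω n) (ω (n + 1)) ∂(M.law σ) = 0 := by
  let f : (Finset.Iic n → Stage S A) × Stage S A → ℝ := fun z =>
    g z.1 * M.transError h (z.1 ⟨n, Finset.mem_Iic.2 le_rfl⟩) z.2
  have hf : Measurable f := by fun_prop
  have hf_le : ∀ z, ‖f z‖ ≤ C * (2 * ‖h‖) := fun z => by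
    rw [norm_mul]
    exact mul_le_mul (hC _) (M.abs_transError_le h _ _) (norm_nonneg _)
      ((abs_nonneg _).trans (hC z.1))
  have h_int : Integrable (fun ω => f (Preorder.frestrictLe n ω, ω (n + 1))) (M.law σ) :=
    Integrable.of_bound (hf.comp (by fun_prop)).aestronglyMeasurable _
      (Eventually.of_forall fun ω => hf_le _)
  calc ∫ ω, f (Preorder.frestrictLe n ω, ω (n + 1)) ∂(M.law σ)
    _ = ∫ ω, ∫ y, f (Preorder.frestrictLe n ω, y)
          ∂(M.stepKernel σ n (Preorder.frestrictLe n ω)) ∂(M.law σ) :=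
      integral_trajMeasure_succ hf.stronglyMeasurable h_int
    _ = 0 := by simp only [f, integral_const_mul, integral_transError_stepKernel, mul_zero,
      integral_zero]

theorem integral_transError_law (t : ℕ) :
    ∫ ω, M.transError h (ω t) (ω (t + 1)) ∂(M.law σ) = 0 := by
  simpa using M.integral_mul_transError_law h σ (n := t) (g := fun _ => 1) measurable_const
    (C := 1) (by simp)

theorem integral_transError_mul_transError_law :
    Pairwise fun s t => ∫ ω, M.transError h (ω s) (ω (s + 1)) * M.transError h (ω t) (ω (t + 1))
      ∂(M.law σ) = 0 := by
  have h_lt : ∀ s t, s < t → ∫ ω, M.transError h (ω s) (ω (s + 1)) *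
      M.transError h (ω t) (ω (t + 1)) ∂(M.law σ) = 0 := fun s t hst =>
    M.integral_mul_transError_law h σ
      (g := fun x => M.transError h (x ⟨s, Finset.mem_Iic.2 hst.le⟩)
        (x ⟨s + 1, Finset.mem_Iic.2 hst⟩))
      (by fun_prop) fun x => M.abs_transError_le h _ _
  intro s t hst
  rcases hst.lt_or_gt with hst | hts
  · exact h_lt s t hst
  · simpa only [mul_comm] using h_lt t s hts

theorem ae_tendsto_sum_transError_div :
    ∀ᵐ ω ∂(M.law σ), Tendsto (fun n : ℕ =>
      (∑ t ∈ Finset.range n, M.transError h (ω t) (ω (t + 1))) / n) atTop (𝓝 0) := by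
  have h_abs : ∀ t (ω : ℕ → Stage S A), |M.transError h (ω t) (ω (t + 1))| ≤ 2 * ‖h‖ :=
    fun t ω => M.abs_transError_le h _ _
  have h_memLp : ∀ t, MemLp (fun ω => M.transError h (ω t) (ω (t + 1))) 2 (M.law σ) := fun t =>
    MemLp.of_bound (Measurable.aestronglyMeasurable (by fun_prop)) _
      (Eventually.of_forall (h_abs t))
  have h_sq : ∀ t, ∫ ω, M.transError h (ω t) (ω (t + 1)) ^ 2 ∂(M.law σ) ≤ (2 * ‖h‖) ^ 2 :=
    fun t => by
      have h_le := integral_mono (h_memLp t).integrable_sq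
        (integrable_const (μ := M.law σ) ((2 * ‖h‖) ^ 2))
        fun ω => sq_le_sq' (abs_le.1 (h_abs t ω)).1 (abs_le.1 (h_abs t ω)).2
      simpa using h_le
  exact ae_tendsto_sum_div_of_orthogonal h_memLp
    (fun t => Eventually.of_forall fun ω => (abs_le.1 (h_abs t ω)).1) h_sq
    (M.integral_transError_mul_transError_law h σ)

end TransError

section Average

variable {S A : Type*} [Fintype S] (M : MDP S A)

theorem meanReward_eq (g : ℝ) (h : S → ℝ) (x y : Stage S A) :
    M.meanReward x.2.1 x.1 =
      g + M.advantage g h x.2.1 x.1 + (M.transError h x y + (h x.1 - h y.1)) := by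
  unfold advantage transError
  ring

theorem pathAverage_eq (g : ℝ) (h : S → ℝ) (ω : ℕ → Stage S A) {n : ℕ} (hn : n ≠ 0) :
    M.pathAverage ω n = g + (∑ t ∈ Finset.range n, M.advantage g h (ω t).2.1 (ω t).1) / n +
      ((∑ t ∈ Finset.range n, M.transError h (ω t) (ω (t + 1))) / n +
        (h (ω 0).1 - h (ω n).1) / n) := by
  simp only [pathAverage, fun t => M.meanReward_eq g h (ω t) (ω (t + 1)), Finset.sum_add_distrib,
    Finset.sum_range_sub' fun t => h (ω t).1, Finset.sum_const, Finset.card_range, nsmul_eq_mul]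
  field_simp

variable [Fintype A] [MeasurableSpace S] [MeasurableSpace A] [DiscreteMeasurableSpace S]
  [DiscreteMeasurableSpace A] (σ : Policy S A) {g : ℝ} {h : S → ℝ}

theorem integral_payoff_law_eq (g : ℝ) (h : S → ℝ) (t : ℕ) :
    ∫ ω, (ω t).2.2 ∂(M.law σ) = g + ∫ ω, M.advantage g h (ω t).2.1 (ω t).1 ∂(M.law σ) +
      (∫ ω, h (ω t).1 ∂(M.law σ) - ∫ ω, h (ω (t + 1)).1 ∂(M.law σ)) := by
  have h_adv : Integrable (fun ω => M.advantage g h (ω t).2.1 (ω t).1) (M.law σ) :=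
    integrable_comp_of_finite (X := fun ω : ℕ → Stage S A => ((ω t).1, (ω t).2.1)) (by fun_prop)
      fun p => M.advantage g h p.2 p.1
  have h_err : Integrable (fun ω => M.transError h (ω t) (ω (t + 1))) (M.law σ) :=
    Integrable.of_bound (Measurable.aestronglyMeasurable (by fun_prop)) _
      (Eventually.of_forall fun ω => M.abs_transError_le h _ _)
  have h_bias : ∀ s, Integrable (fun ω => h (ω s).1) (M.law σ) := fun s =>
    integrable_comp_of_finite (X := fun ω : ℕ → Stage S A => (ω s).1) (by fun_prop) h
  have h_diff : Integrable (fun ω => h (ω t).1 - h (ω (t + 1)).1) (M.law σ) :=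
    (h_bias t).sub (h_bias (t + 1))
  calc ∫ ω, (ω t).2.2 ∂(M.law σ)
    _ = ∫ ω, (g + M.advantage g h (ω t).2.1 (ω t).1 +
          (M.transError h (ω t) (ω (t + 1)) + (h (ω t).1 - h (ω (t + 1)).1))) ∂(M.law σ) := by
      simp only [integral_payoff_law, fun ω : ℕ → Stage S A =>
        M.meanReward_eq g h (ω t) (ω (t + 1))]
    _ = ∫ ω, (g + M.advantage g h (ω t).2.1 (ω t).1) ∂(M.law σ) +
          ∫ ω, (M.transError h (ω t) (ω (t + 1)) + (h (ω t).1 - h (ω (t + 1)).1)) ∂(M.law σ) :=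
      integral_add ((integrable_const g).add h_adv) (h_err.add h_diff)
    _ = g + ∫ ω, M.advantage g h (ω t).2.1 (ω t).1 ∂(M.law σ) +
          (∫ ω, h (ω t).1 ∂(M.law σ) - ∫ ω, h (ω (t + 1)).1 ∂(M.law σ)) := by
      rw [integral_add (integrable_const g) h_adv, integral_add h_err h_diff,
        integral_sub (h_bias t) (h_bias (t + 1)), integral_transError_law, zero_add]
      simp

theorem expectedAverage_eq (g : ℝ) (h : S → ℝ) {n : ℕ} (hn : n ≠ 0) :
    M.expectedAverage σ n =
      g + (∑ t ∈ Finset.range n, ∫ ω, M.advantage g h (ω t).2.1 (ω t).1 ∂(M.law σ)) / n +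
        (∫ ω, h (ω 0).1 ∂(M.law σ) - ∫ ω, h (ω n).1 ∂(M.law σ)) / n := by
  rw [expectedAverage, integral_div, integral_finsetSum _ fun t _ => M.integrable_payoff_law σ t]
  simp only [M.integral_payoff_law_eq σ g h, Finset.sum_add_distrib,
    Finset.sum_range_sub' fun t => ∫ ω, h (ω t).1 ∂(M.law σ), Finset.sum_const, Finset.card_range,
    nsmul_eq_mul]
  field_simp

theorem tendsto_integral_sub_div (h : S → ℝ) :
    Tendsto (fun n : ℕ => (∫ ω, h (ω 0).1 ∂(M.law σ) - ∫ ω, h (ω n).1 ∂(M.law σ)) / n)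
      atTop (𝓝 0) := by
  refine tendsto_sub_div_of_abs_le (u := fun n => ∫ ω, h (ω n).1 ∂(M.law σ)) (K := ‖h‖) fun n => ?_
  simpa using norm_integral_le_of_norm_le_const (μ := M.law σ)
    (Eventually.of_forall fun ω : ℕ → Stage S A => norm_le_pi_norm h (ω n).1)

theorem eventually_expectedAverage_lt (hle : ∀ a i, M.advantage g h a i ≤ 0) {ε : ℝ}
    (hε : 0 < ε) : ∀ᶠ n in atTop, M.expectedAverage σ n < g + ε := by
  filter_upwards [(M.tendsto_integral_sub_div σ h).eventually_lt_const hε, eventually_ne_atTop 0]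
    with n h_bias hn
  have h_adv : (∑ t ∈ Finset.range n, ∫ ω, M.advantage g h (ω t).2.1 (ω t).1 ∂(M.law σ)) / n ≤
      (0 : ℝ) :=
    div_nonpos_of_nonpos_of_nonneg
      (Finset.sum_nonpos fun t _ => integral_nonpos fun ω => hle _ _) n.cast_nonneg
  linarith [M.expectedAverage_eq σ g h hn]

variable {M σ} (h0 : ∀ t : ℕ, ∀ᵐ ω ∂(M.law σ), M.advantage g h (ω t).2.1 (ω t).1 = 0)
include h0

theorem tendsto_expectedAverage_of_advantage_eq_zero :
    Tendsto (M.expectedAverage σ) atTop (𝓝 g) := by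
  have h_lim := (M.tendsto_integral_sub_div σ h).const_add g
  rw [add_zero] at h_lim
  refine h_lim.congr' ?_
  filter_upwards [eventually_ne_atTop 0] with n hn
  rw [M.expectedAverage_eq σ g h hn, Finset.sum_eq_zero fun t _ => integral_eq_zero_of_ae (h0 t),
    zero_div, add_zero]

theorem ae_tendsto_pathAverage_of_advantage_eq_zero :
    ∀ᵐ ω ∂(M.law σ), Tendsto (M.pathAverage ω) atTop (𝓝 g) := by
  filter_upwards [ae_all_iff.2 h0, M.ae_tendsto_sum_transError_div h σ] with ω hω h_err
  have h_bias : Tendsto (fun n : ℕ => (h (ω 0).1 - h (ω n).1) / n) atTop (𝓝 0) :=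
    tendsto_sub_div_of_abs_le fun n => norm_le_pi_norm h (ω n).1
  have h_lim := (h_err.add h_bias).const_add g
  rw [add_zero, add_zero] at h_lim
  refine h_lim.congr' ?_
  filter_upwards [eventually_ne_atTop 0] with n hn
  rw [M.pathAverage_eq g h ω hn, Finset.sum_eq_zero fun t _ => hω t, zero_div, add_zero]

end Average

end MDP

theorem theorem2 {S A : Type*} [Fintype S] [Fintype A]
    [MeasurableSpace S] [MeasurableSpace A]
    [DiscreteMeasurableSpace S] [DiscreteMeasurableSpace A]
    (M : MDP S A) (hM : M.IsUnichain)
    (Ps : Set (S → A)) (hPs : ∀ π ∈ Ps, M.IsOptimal π)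
    (σ : Policy S A) (hσ : σ.Mixes Ps) :
    M.IsOptimalPolicy σ ∧
      ∀ᵐ ω ∂(M.law σ), Tendsto (M.pathAverage ω) atTop (𝓝 M.optimalValue) := by
  obtain ⟨ω₀⟩ : Nonempty (ℕ → Stage S A) := (M.law σ).nonempty_of_neZero
  have : Nonempty A := ⟨(ω₀ 0).2.1⟩
  obtain ⟨h, h_nonpos, h_zero⟩ := MDP.exists_optimality_equation hM
  have h_along : ∀ t, ∀ᵐ ω ∂(M.law σ), M.advantage M.optimalValue h (ω t).2.1 (ω t).1 = 0 :=
    fun t => by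
      filter_upwards [M.ae_exists_eq_of_mixes t hσ] with ω ⟨π, hπ, hω⟩
      rw [hω]
      exact h_zero π (hPs π hπ) _
  exact ⟨⟨⟨M.integrable_payoff_law σ, MDP.tendsto_expectedAverage_of_advantage_eq_zero h_along⟩,
    fun σ' ε hε => M.eventually_expectedAverage_lt σ' h_nonpos hε⟩,
    MDP.ae_tendsto_pathAverage_of_advantage_eq_zero h_along⟩
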